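/- Let $G$ be a connected complex linear algebraic group, $V$ a finite-dimensional complex vector space and $\rho:G\to \mathrm{GL}(V)$ a rational representation with a Zariski open orbit $\Omega\subseteq V$ (that is, $(G,\rho,V)$ is a prehomogeneous vector space). For a group $K$ with an algebra of regular functions, let $\mathscr A(K)$ be the complex vector space of additive functions of $K$, i.e. of regular functions $\Phi:K\to\mathbb C$ with $\Phi(xy)=\Phi(x)+\Phi(y)$ for all $x,y\in K$. A rational function $h$ on $V$ is an additive relative invariant associated to $\Phi\in\mathscr A(G)$, written $h\leftrightarrow\Phi$, if $h$ is defined at every point of $\Omega$ and $$h(\rho(g)(v))-h(v)=\Phi(g)\qquad\text{for all } v\in\Omega,\ g\in G.$$ Let $\mathscr A_1(G)\subseteq\mathscr A(G)$ be the subspace of those $\Phi$ for which there is a rational function $h$ on $V$ with $h\leftrightarrow\Phi$. Let $v_0\in\Omega$, let $G_{v_0}$ be its isotropy subgroup, let $H=G/([G,G]\cdot G_{v_0})$ be the quotient group, whose regular functions are the functions with regular pullback to $G$, and let $\pi:G\to H$ be the quotient map. Then $\mathscr A_1(G)$ and $\mathscr A(H)$ are isomorphic as complex vector spaces; more precisely,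 there is a linear isomorphism $\mathscr A_1(G)\to\mathscr A(H)$, $\Phi\mapsto\overline\Phi$, with $\overline\Phi\circ\pi=\Phi$. Consequently additive functions of $H$ correspond, up to constants, to additive relative invariants: 1. for every $\Psi\in\mathscr A(H)$ there is a rational function $h$ on $V$ with $h\leftrightarrow\Psi\circ\pi$; 2. for every additive relative invariant $h$ there is exactly one $\Psi\in\mathscr A(H)$ with $h\leftrightarrow\Psi\circ\pi$; 3. if $h_1\leftrightarrow\Phi$, then a rational function $h_2$ on $V$ satisfies $h_2\leftrightarrow\Phi$ if and only if $h_2=h_1+c$ for some $c\in\mathbb C$. -/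

import Mathlib

/-! # Additive functions and additive relative invariants of prehomogeneous vector spaces

Varieties are treated classically: an affine variety over `ℂ` is a set of points together with its
algebra of regular functions, a subalgebra of the algebra of all complex functions on the set. -/

/-- The Zariski topology on a set `X` with algebra of regular functions `O`:
the sets `{x | f x ≠ 0}`, `f ∈ O`, form a basis of the open sets. -/
abbrev zariskiTopology {X : Type*} (O : Subalgebra ℂ (X → ℂ)) : TopologicalSpace X :=
  TopologicalSpace.generateFrom {U | ∃ f ∈ O, U = {x | f x ≠ 0}}

/-- A group `G` with an algebra `O` of complex functions is a (complex) linear algebraic group with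
coordinate ring `O` : it is an affine variety whose multiplication and inversion are morphisms. -/
structure IsLinearAlgebraicGroup {G : Type*} [Group G] (O : Subalgebra ℂ (G → ℂ)) : Prop where
  /-- The coordinate ring is a finitely generated algebra. -/
  finitely_generated : O.FG
  /-- The points of `G` are exactly the points of the affine variety with coordinate ring `O`. -/
  points : ∀ φ : O →ₐ[ℂ] ℂ, ∃! x : G, ∀ f : O, φ f = (f : G → ℂ) x
  /-- Multiplication is a morphism `G × G → G`; the regular functions on `G × G` are the finite sums
  of products `a x * b y` with `a` and `b` regular on `G`. -/
  mul_regular : ∀ f ∈ O, ∃ (n : ℕ) (a b : Fin n → G → ℂ),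
    (∀ i, a i ∈ O) ∧ (∀ i, b i ∈ O) ∧ ∀ x y : G, f (x * y) = ∑ i, a i x * b i y
  /-- Inversion is a morphism. -/
  inv_regular : ∀ f ∈ O, (fun x : G => f x⁻¹) ∈ O

/-- `G` is connected in its Zariski topology. -/
def IsZariskiConnected {X : Type*} (O : Subalgebra ℂ (X → ℂ)) : Prop :=
  @ConnectedSpace X (zariskiTopology O)

/-- The coordinate ring of the quotient `G ⧸ N` : a function on the quotient is regular
if and only if its pullback to `G` is regular. -/
def quotientRegular {G : Type*} [Group G] (O : Subalgebra ℂ (G → ℂ)) (N : Subgroup G) :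
    Subalgebra ℂ (G ⧸ N → ℂ) where
  carrier := {f | (fun g : G => f (g : G ⧸ N)) ∈ O}
  mul_mem' := fun ha hb => O.mul_mem ha hb
  add_mem' := fun ha hb => O.add_mem ha hb
  algebraMap_mem' := fun c => O.algebraMap_mem c

/-- The vector space `𝒜(K)` of additive functions of `K` : homomorphisms of algebraic groups from
`K` to the additive group of `ℂ`. -/
def additiveFunctions {K : Type*} [Group K] (O : Subalgebra ℂ (K → ℂ)) :
    Submodule ℂ (K → ℂ) where
  carrier := {Φ | Φ ∈ O ∧ ∀ x y : K, Φ (x * y) = Φ x + Φ y}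
  zero_mem' := ⟨O.zero_mem, fun _ _ => by simp⟩
  add_mem' := fun {a b} ha hb => ⟨O.add_mem ha.1 hb.1, fun x y => by
    simp only [Pi.add_apply, ha.2, hb.2]; ring⟩
  smul_mem' := fun c a ha => ⟨O.smul_mem ha.1 c, fun x y => by
    simp only [Pi.smul_apply, ha.2, smul_add]⟩

/-- The algebra `ℂ[V]` of polynomial functions on the vector space `V`, generated by the linear
functionals. -/
def coordinateRing (V : Type*) [AddCommGroup V] [Module ℂ V] : Subalgebra ℂ (V → ℂ) :=
  Algebra.adjoin ℂ {f | ∃ l : Module.Dual ℂ V, f = fun v => l v}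

/-- The field `ℂ(V)` of rational functions on `V`, the field of fractions of `ℂ[V]`. -/
abbrev RationalFunctions (V : Type*) [AddCommGroup V] [Module ℂ V] : Type _ :=
  FractionRing (coordinateRing V)

/-- The rational function `h` is defined at `v` and has the value `c` there : `h = p / q` for
polynomial functions `p` and `q` with `q v ≠ 0` and `c = p v / q v`. -/
def HasValueAt {V : Type*} [AddCommGroup V] [Module ℂ V] (h : RationalFunctions V) (v : V)
    (c : ℂ) : Prop :=
  ∃ p q : coordinateRing V, (q : V → ℂ) v ≠ 0 ∧
    h * algebraMap (coordinateRing V) (RationalFunctions V) q =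
      algebraMap (coordinateRing V) (RationalFunctions V) p ∧
    c = (p : V → ℂ) v / (q : V → ℂ) v

section Representations

variable {G V : Type*} [Group G] [AddCommGroup V] [Module ℂ V]

/-- The representation `ρ` is rational, i.e. a morphism of algebraic groups `G → GL(V)` :
its matrix coefficients are regular functions on `G`. -/
def IsRationalRepresentation (O : Subalgebra ℂ (G → ℂ)) (ρ : Representation ℂ G V) : Prop :=
  ∀ (l : Module.Dual ℂ V) (v : V), (fun g : G => l (ρ g v)) ∈ O

/-- `(G, ρ, V)` is a prehomogeneous vector space with open orbit `Ω` : `G` is a connected linear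
algebraic group with coordinate ring `O`, `ρ` is a rational representation, and
`Ω` is an orbit that is Zariski open in `V`. -/
structure IsPrehomogeneous (O : Subalgebra ℂ (G → ℂ)) (ρ : Representation ℂ G V)
    (Ω : Set V) : Prop where
  algebraic : IsLinearAlgebraicGroup O
  connected : IsZariskiConnected O
  rational : IsRationalRepresentation O ρ
  orbit : ∃ v : V, Ω = Set.range (fun g : G => ρ g v)
  isOpen : @IsOpen V (zariskiTopology (coordinateRing V)) Ω

/-- The isotropy subgroup of `G` at `v`. -/
def isotropy (ρ : Representation ℂ G V) (v : V) : Subgroup G where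
  carrier := {g | ρ g v = v}
  one_mem' := by simp
  mul_mem' := fun {a b} (ha : ρ a v = v) (hb : ρ b v = v) => by
    change ρ (a * b) v = v
    rw [map_mul, Module.End.mul_apply, hb, ha]
  inv_mem' := fun {a} (ha : ρ a v = v) => by
    change ρ a⁻¹ v = v
    conv_lhs => rw [← ha]
    rw [← Module.End.mul_apply, ← map_mul, inv_mul_cancel, map_one, Module.End.one_apply]

/-- The subgroup `[G, G] · G_v` of `G`. -/
def commutatorIsotropy (ρ : Representation ℂ G V) (v : V) : Subgroup G :=
  commutator G ⊔ isotropy ρ v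

instance commutatorIsotropy_normal (ρ : Representation ℂ G V) (v : V) :
    (commutatorIsotropy ρ v).Normal :=
  Subgroup.Normal.of_commutator_le _ (le_sup_left : commutator G ≤ commutatorIsotropy ρ v)

/-- `h` is an additive relative invariant (with open orbit `Ω`) associated to the additive function
`Φ` of `G` : `h` is defined on `Ω` and `h (ρ g v) - h v = Φ g` for all `v ∈ Ω` and `g`. -/
def IsAssociated (O : Subalgebra ℂ (G → ℂ)) (ρ : Representation ℂ G V) (Ω : Set V)
    (h : RationalFunctions V) (Φ : G → ℂ) : Prop :=
  Φ ∈ additiveFunctions O ∧ ∀ v ∈ Ω, ∀ g : G, ∃ a b : ℂ,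
    HasValueAt h (ρ g v) a ∧ HasValueAt h v b ∧ a - b = Φ g

/-- `h` is an additive relative invariant. -/
def IsAdditiveRelativeInvariant (O : Subalgebra ℂ (G → ℂ)) (ρ : Representation ℂ G V) (Ω : Set V)
    (h : RationalFunctions V) : Prop :=
  ∃ Φ : G → ℂ, IsAssociated O ρ Ω h Φ

theorem HasValueAt.const (v : V) (c : ℂ) :
    HasValueAt (algebraMap ℂ (RationalFunctions V) c) v c :=
  ⟨algebraMap ℂ (coordinateRing V) c, 1, by simp, by
    rw [map_one, mul_one, ← IsScalarTower.algebraMap_apply], by simp⟩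

theorem HasValueAt.add {h k : RationalFunctions V} {v : V} {c d : ℂ}
    (hc : HasValueAt h v c) (kd : HasValueAt k v d) : HasValueAt (h + k) v (c + d) := by
  obtain ⟨p, q, hq, e, rfl⟩ := hc
  obtain ⟨p', q', hq', e', rfl⟩ := kd
  refine ⟨p * q' + p' * q, q * q', mul_ne_zero hq hq', ?_, ?_⟩
  · rw [map_mul, map_add, map_mul, map_mul, ← e, ← e', add_mul, ← mul_assoc,
      mul_assoc k, mul_comm (algebraMap _ (RationalFunctions V) q), ← mul_assoc]
  · exact div_add_div _ _ hq hq' |>.trans (by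
      simp only [Subalgebra.coe_add, Subalgebra.coe_mul, Pi.add_apply, Pi.mul_apply]; ring)

theorem HasValueAt.mul {h k : RationalFunctions V} {v : V} {c d : ℂ}
    (hc : HasValueAt h v c) (kd : HasValueAt k v d) : HasValueAt (h * k) v (c * d) := by
  obtain ⟨p, q, hq, e, rfl⟩ := hc
  obtain ⟨p', q', hq', e', rfl⟩ := kd
  refine ⟨p * p', q * q', mul_ne_zero hq hq', ?_, ?_⟩
  · rw [map_mul, map_mul, ← e, ← e']
    exact mul_mul_mul_comm _ _ _ _
  · exact div_mul_div_comm _ _ _ _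

/-- The vector space `𝒜₁(G)` of those additive functions of `G` that are associated to an additive
relative invariant. -/
def additiveFunctionsOne (O : Subalgebra ℂ (G → ℂ)) (ρ : Representation ℂ G V) (Ω : Set V) :
    Submodule ℂ (G → ℂ) where
  carrier := {Φ | ∃ h : RationalFunctions V, IsAssociated O ρ Ω h Φ}
  zero_mem' := ⟨algebraMap ℂ _ 0, Submodule.zero_mem _, fun v _ g =>
    ⟨0, 0, HasValueAt.const _ 0, HasValueAt.const _ 0, by simp⟩⟩
  add_mem' := by
    rintro Φ Ψ ⟨h, hΦ, H⟩ ⟨k, hΨ, K⟩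
    refine ⟨h + k, Submodule.add_mem _ hΦ hΨ, fun v hv g => ?_⟩
    obtain ⟨a, b, ha, hb, e⟩ := H v hv g
    obtain ⟨a', b', ha', hb', e'⟩ := K v hv g
    exact ⟨a + a', b + b', ha.add ha', hb.add hb', by rw [Pi.add_apply, ← e, ← e']; ring⟩
  smul_mem' := by
    rintro c Φ ⟨h, hΦ, H⟩
    refine ⟨algebraMap ℂ _ c * h, Submodule.smul_mem _ c hΦ, fun v hv g => ?_⟩
    obtain ⟨a, b, ha, hb, e⟩ := H v hv g
    exact ⟨c * a, c * b, (HasValueAt.const _ c).mul ha, (HasValueAt.const _ c).mul hb, by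
      rw [Pi.smul_apply, smul_eq_mul, ← e]; ring⟩

end Representations

/-!
The only part of the theorem that is not formal is the existence of a rational function on `V`
associated to an additive function `Φ` of `G` that vanishes on the isotropy subgroup of `v₀`. Such a
`Φ` is constant on the fibres of the orbit map `g ↦ ρ g v₀`, so it is a function on the orbit `Ω`;
the problem is that this function is rational.

First, `Φ` is algebraic over `ℂ[V]` (`graphIdeal_ne_bot`): otherwise `g ↦ (ρ g v₀, Φ g)` is a
dominant morphism from `G` to `V × ℂ`, its image contains a nonempty open set by Chevalley's theorem
(`AlgHom.exists_forall_apply_ne_zero_exists_comp_eq`), and two points of this open set over the same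
point of `V` contradict the constancy of `Φ` on the fibres.

Secondly, let `a T ^ n + b T ^ (n - 1) + ⋯` be a polynomial of least degree over `ℂ[V]` that is
satisfied by `Φ`. For `g` in `G` the substitution `(v, T) ↦ (ρ g v, T + Φ g)` gives another one of
the same degree, which is therefore proportional to it. Comparison of the coefficients of `T ^ n` and
`T ^ (n - 1)` shows that the rational function `h = - b / (n a)` satisfies
`h (ρ g v) = h v + Φ g` (`exists_polynomial_mul_eq_add`). As every point of `Ω` is moved by some `g`
into the locus `a ≠ 0`, this relation also shows that `h` is defined on all of `Ω`
(`exists_isAssociated`). Characteristic zero enters through the division by `n`.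

Conversely, if `h` is associated to `Φ`, then `Φ g = h (ρ g v₀) - h v₀` vanishes on the isotropy
subgroup, and it vanishes on commutators because `ℂ` is commutative; so it descends to the quotient.
Two rational functions associated to the same `Φ` differ by a function that is constant on the dense
set `Ω`.
-/

/-! ### Lifting points along dominant morphisms -/

/-- A constructible set or its complement is a neighbourhood of a generic point `η`. -/
theorem Topology.IsConstructible.exists_isOpen_subset_or_subset_compl {X : Type*}
    [TopologicalSpace X] {η : X} (hη : ∀ U : Set X, IsOpen U → U.Nonempty → η ∈ U) {s : Set X}
    (hs : Topology.IsConstructible s) :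
    ∃ U : Set X, IsOpen U ∧ η ∈ U ∧ (U ⊆ s ∨ U ⊆ sᶜ) := by
  induction hs using Topology.IsConstructible.empty_union_induction with
  | open_retrocompact U hU _ =>
    by_cases h : U.Nonempty
    · exact ⟨U, hU, hη U hU h, Or.inl subset_rfl⟩
    · refine ⟨Set.univ, isOpen_univ, Set.mem_univ _, Or.inr ?_⟩
      rw [Set.not_nonempty_iff_eq_empty.1 h, Set.compl_empty]
  | union s _ t _ hs ht =>
    obtain ⟨U, hU, hηU, hUs⟩ := hs
    obtain ⟨W, hW, hηW, hWt⟩ := ht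
    refine ⟨U ∩ W, hU.inter hW, ⟨hηU, hηW⟩, ?_⟩
    rcases hUs with hUs | hUs
    · exact Or.inl fun x hx => Or.inl (hUs hx.1)
    rcases hWt with hWt | hWt
    · exact Or.inl fun x hx => Or.inr (hWt hx.2)
    · exact Or.inr fun x hx h => h.elim (hUs hx.1) (hWt hx.2)
  | compl s _ hs =>
    obtain ⟨U, hU, hηU, h⟩ := hs
    exact ⟨U, hU, hηU, by rw [compl_compl]; exact h.symm⟩

/-- A dominant morphism of finite presentation to an integral affine scheme has a nonempty open subset
in its image: by Chevalley's theorem the image is constructible, and it contains the generic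
point. -/
theorem PrimeSpectrum.exists_basicOpen_subset_range_comap {A B : Type*} [CommRing A] [IsDomain A]
    [CommRing B] {f : A →+* B} (hf : f.FinitePresentation) (hinj : Function.Injective f) :
    ∃ s : A, s ≠ 0 ∧ (basicOpen s : Set (PrimeSpectrum A)) ⊆ Set.range (comap f) := by
  have hη : ∀ U : Set (PrimeSpectrum A), IsOpen U → U.Nonempty → (⊥ : PrimeSpectrum A) ∈ U := by
    rintro U hU ⟨x, hx⟩
    exact ((le_iff_specializes ⊥ x).1 bot_le).mem_open hU hx
  obtain ⟨U, hU, hηU, h⟩ :=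
    (isConstructible_range_comap hf).exists_isOpen_subset_or_subset_compl hη
  have hmem : (⊥ : PrimeSpectrum A) ∈ Set.range (comap f) := by
    obtain ⟨q, hq, h⟩ := Ideal.exists_comap_eq_of_mem_minimalPrimes_of_injective hinj
      (⊥ : Ideal A) (by rw [IsDomain.minimalPrimes_eq_singleton_bot]; rfl)
    exact ⟨⟨q, hq⟩, PrimeSpectrum.ext h⟩
  have hUs : U ⊆ Set.range (comap f) := h.resolve_right fun h => h hηU hmem
  obtain ⟨_, ⟨s, rfl⟩, hs, hsU⟩ :=
    isTopologicalBasis_basic_opens.exists_subset_of_mem_open hηU hU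
  exact ⟨s, fun h0 => hs (by rw [h0]; exact Ideal.zero_mem _), hsU.trans hUs⟩

/-- Over an algebraically closed field, almost all points of an irreducible affine variety lift along
a dominant morphism of affine varieties. -/
theorem AlgHom.exists_forall_apply_ne_zero_exists_comp_eq {k A B : Type*} [Field k] [IsAlgClosed k]
    [CommRing A] [IsDomain A] [Algebra k A] [Algebra.FiniteType k A] [CommRing B] [Algebra k B]
    [Algebra.FiniteType k B] (f : A →ₐ[k] B) (hinj : Function.Injective f) :
    ∃ s : A, s ≠ 0 ∧ ∀ φ : A →ₐ[k] k, φ s ≠ 0 → ∃ ψ : B →ₐ[k] k, ψ.comp f = φ := by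
  have : IsNoetherianRing A := Algebra.FiniteType.isNoetherianRing k A
  have hft : (f : A →+* B).FiniteType := by
    refine RingHom.FiniteType.of_comp_finiteType (f := algebraMap k A) ?_
    rw [f.comp_algebraMap]
    exact (RingHom.finiteType_algebraMap).2 inferInstance
  obtain ⟨s, hs, H⟩ := PrimeSpectrum.exists_basicOpen_subset_range_comap
    (RingHom.FinitePresentation.of_finiteType.1 hft) hinj
  refine ⟨s, hs, fun φ hφ => ?_⟩
  have hmax : (RingHom.ker φ).IsMaximal := RingHom.ker_isMaximal_of_surjective φ fun c =>
    ⟨algebraMap k A c, by simp⟩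
  obtain ⟨q, hq⟩ := H (show (⟨RingHom.ker φ, hmax.isPrime⟩ : PrimeSpectrum A) ∈ _ from hφ)
  obtain ⟨M, hM, hqM⟩ := q.asIdeal.exists_le_maximal q.2.ne_top
  have hcomap : RingHom.ker φ = M.comap (f : A →+* B) := by
    refine hmax.eq_of_le (Ideal.comap_ne_top _ hM.ne_top) ?_
    have h := congrArg PrimeSpectrum.asIdeal hq
    exact h.symm.le.trans (Ideal.comap_mono hqM)
  let _ : Field (B ⧸ M) := Ideal.Quotient.field M
  have : Module.Finite k (B ⧸ M) := finite_of_finite_type_of_isJacobsonRing k (B ⧸ M)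
  let e : k ≃ₐ[k] B ⧸ M := AlgEquiv.ofBijective (Algebra.ofId k (B ⧸ M))
    (IsAlgClosed.algebraMap_bijective_of_isIntegral (k := k) (K := B ⧸ M))
  refine ⟨(e.symm : (B ⧸ M) →ₐ[k] k).comp (Ideal.Quotient.mkₐ k M), AlgHom.ext fun a => ?_⟩
  have ha : a - algebraMap k A (φ a) ∈ M.comap (f : A →+* B) := by
    rw [← hcomap, RingHom.mem_ker]; simp
  have ha' : Ideal.Quotient.mk M (f a) = algebraMap k (B ⧸ M) (φ a) := by
    have h : f (a - algebraMap k A (φ a)) ∈ M := ha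
    rw [map_sub, AlgHom.commutes] at h
    exact Ideal.Quotient.eq.2 h
  change e.symm (Ideal.Quotient.mk M (f a)) = φ a
  rw [ha', AlgEquiv.commutes]; rfl

/-! ### Polynomial and rational functions on a vector space -/

section CoordinateRing

variable {V : Type*} [AddCommGroup V] [Module ℂ V]

theorem MvPolynomial.aeval_coord_injective {ι : Type*} [Finite ι] (b : Module.Basis ι ℂ V) :
    Function.Injective (aeval (R := ℂ) fun i (v : V) => b.coord i v) := by
  rw [injective_iff_map_eq_zero]
  intro p hp
  refine MvPolynomial.funext fun x => ?_
  have h := congrFun hp (b.equivFun.symm x)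
  have he : (Pi.evalAlgHom ℂ (fun _ : V => ℂ) (b.equivFun.symm x)).comp
      (aeval (R := ℂ) fun i (v : V) => b.coord i v) = aeval x := by
    ext i
    simp [← Module.Basis.equivFun_apply]
  have h' := DFunLike.congr_fun he p
  rw [map_zero, ← MvPolynomial.aeval_eq_eval, ← h']
  exact h

theorem range_aeval_coord {ι : Type*} [Finite ι] (b : Module.Basis ι ℂ V) :
    (MvPolynomial.aeval (R := ℂ) fun i (v : V) => b.coord i v).range = coordinateRing V := by
  cases nonempty_fintype ι
  rw [← Algebra.adjoin_range_eq_range_aeval]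
  refine le_antisymm (Algebra.adjoin_mono ?_) (Algebra.adjoin_le ?_)
  · rintro _ ⟨i, rfl⟩
    exact ⟨b.coord i, rfl⟩
  · rintro _ ⟨l, rfl⟩
    have hl : (fun v => l v) = ∑ i, l (b i) • fun v : V => b.coord i v := by
      funext v
      rw [← congrArg l (b.sum_repr v), map_sum]
      simp [mul_comm]
    rw [hl]
    exact Subalgebra.sum_mem _ fun i _ => Subalgebra.smul_mem _
      (Algebra.subset_adjoin (Set.mem_range_self i)) _

/-- A basis of `V` identifies `ℂ[V]` with the polynomial ring in the coordinates. -/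
noncomputable def coordinateRingEquiv {ι : Type*} [Finite ι] (b : Module.Basis ι ℂ V) :
    MvPolynomial ι ℂ ≃ₐ[ℂ] coordinateRing V :=
  (AlgEquiv.ofInjective _ (MvPolynomial.aeval_coord_injective b)).trans
    (Subalgebra.equivOfEq _ _ (range_aeval_coord b))

instance [FiniteDimensional ℂ V] : IsDomain (coordinateRing V) :=
  (coordinateRingEquiv (Module.finBasis ℂ V)).symm.toMulEquiv.isDomain _

instance [FiniteDimensional ℂ V] : Algebra.FiniteType ℂ (coordinateRing V) :=
  Algebra.FiniteType.equiv inferInstance (coordinateRingEquiv (Module.finBasis ℂ V))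

/-- Evaluation of polynomial functions at a point of `V`. -/
def coordinateRing.eval (v : V) : coordinateRing V →ₐ[ℂ] ℂ :=
  (Pi.evalAlgHom ℂ (fun _ : V => ℂ) v).comp (coordinateRing V).val

@[simp]
theorem coordinateRing.eval_apply (v : V) (p : coordinateRing V) :
    coordinateRing.eval v p = (p : V → ℂ) v := rfl

/-- Pullback of polynomial functions along a map `u : X → V` whose composites with linear
functionals are regular. -/
def coordinateRing.pullback {X : Type*} {O : Subalgebra ℂ (X → ℂ)} (u : X → V)
    (hu : ∀ l : Module.Dual ℂ V, (fun x => l (u x)) ∈ O) : coordinateRing V →ₐ[ℂ] O where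
  toFun p := ⟨fun x => (p : V → ℂ) (u x), by
    refine Algebra.adjoin_induction (p := fun f _ => (fun x => f (u x)) ∈ O) ?_ ?_ ?_ ?_ p.2
    · rintro _ ⟨l, rfl⟩
      exact hu l
    · exact fun c => O.algebraMap_mem c
    · exact fun _ _ _ _ hf hg => O.add_mem hf hg
    · exact fun _ _ _ _ hf hg => O.mul_mem hf hg⟩
  map_one' := rfl
  map_mul' _ _ := rfl
  map_zero' := rfl
  map_add' _ _ := rfl
  commutes' _ := rfl

@[simp]
theorem coordinateRing.pullback_apply {X : Type*} {O : Subalgebra ℂ (X → ℂ)} (u : X → V)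
    (hu : ∀ l : Module.Dual ℂ V, (fun x => l (u x)) ∈ O) (p : coordinateRing V) (x : X) :
    (coordinateRing.pullback u hu p : X → ℂ) x = (p : V → ℂ) (u x) := rfl

/-- Composition of polynomial functions with an endomorphism of `V`. -/
def coordinateRing.precomp (T : V →ₗ[ℂ] V) : coordinateRing V →ₐ[ℂ] coordinateRing V :=
  coordinateRing.pullback T fun l => Algebra.subset_adjoin ⟨l.comp T, rfl⟩

@[simp]
theorem coordinateRing.precomp_apply (T : V →ₗ[ℂ] V) (p : coordinateRing V) (v : V) :
    (coordinateRing.precomp T p : V → ℂ) v = (p : V → ℂ) (T v) := rfl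

theorem exists_mem_subset_of_isOpen_zariskiTopology {X : Type*} {O : Subalgebra ℂ (X → ℂ)}
    {U : Set X} (hU : @IsOpen X (zariskiTopology O) U) {x : X} (hx : x ∈ U) :
    ∃ f ∈ O, f x ≠ 0 ∧ {y | f y ≠ 0} ⊆ U := by
  change TopologicalSpace.GenerateOpen _ U at hU
  induction hU with
  | basic s hs =>
    obtain ⟨f, hf, rfl⟩ := hs
    exact ⟨f, hf, hx, subset_rfl⟩
  | univ => exact ⟨1, O.one_mem, one_ne_zero, Set.subset_univ _⟩
  | inter s t _ _ hs ht =>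
    obtain ⟨f, hf, hfx, hfs⟩ := hs hx.1
    obtain ⟨g, hg, hgx, hgt⟩ := ht hx.2
    exact ⟨f * g, O.mul_mem hf hg, mul_ne_zero hfx hgx, fun y hy =>
      ⟨hfs (left_ne_zero_of_mul hy), hgt (right_ne_zero_of_mul hy)⟩⟩
  | sUnion S _ hS =>
    obtain ⟨s, hs, hxs⟩ := hx
    obtain ⟨f, hf, hfx, hfs⟩ := hS s hs hxs
    exact ⟨f, hf, hfx, hfs.trans (Set.subset_sUnion_of_mem hs)⟩

/-- Nonempty Zariski open subsets of `V` are dense, because `ℂ[V]` is a domain. -/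
theorem coordinateRing.eq_zero_of_forall_mem_isOpen [FiniteDimensional ℂ V] {U : Set V}
    (hU : @IsOpen V (zariskiTopology (coordinateRing V)) U) (hne : U.Nonempty)
    {p : coordinateRing V} (hp : ∀ v ∈ U, (p : V → ℂ) v = 0) : p = 0 := by
  obtain ⟨x, hx⟩ := hne
  obtain ⟨f, hf, hfx, hfU⟩ := exists_mem_subset_of_isOpen_zariskiTopology hU hx
  have hmul : p * ⟨f, hf⟩ = 0 := by
    refine Subtype.ext (funext fun v => ?_)
    by_cases hv : f v = 0
    · exact mul_eq_zero_of_right _ hv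
    · exact mul_eq_zero_of_left (hp v (hfU hv)) _
  refine (mul_eq_zero.1 hmul).resolve_right fun h => hfx ?_
  exact congrFun (congrArg Subtype.val h) x

theorem HasValueAt.unique [FiniteDimensional ℂ V] {h : RationalFunctions V} {v : V} {c d : ℂ}
    (hc : HasValueAt h v c) (hd : HasValueAt h v d) : c = d := by
  obtain ⟨p, q, hq, e, rfl⟩ := hc
  obtain ⟨p', q', hq', e', rfl⟩ := hd
  have hpq : p * q' = p' * q := by
    apply IsFractionRing.injective (coordinateRing V) (RationalFunctions V)
    rw [map_mul, map_mul, ← e, ← e', mul_right_comm]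
  rw [div_eq_div_iff hq hq']
  exact congrFun (congrArg Subtype.val hpq) v

/-- A rational function is determined by its values on a nonempty Zariski open set. -/
theorem RationalFunctions.eq_zero_of_hasValueAt_zero [FiniteDimensional ℂ V] {U : Set V}
    (hU : @IsOpen V (zariskiTopology (coordinateRing V)) U) (hne : U.Nonempty)
    {h : RationalFunctions V} (hh : ∀ v ∈ U, HasValueAt h v 0) : h = 0 := by
  obtain ⟨p, q, hq, rfl⟩ := IsFractionRing.div_surjective (A := coordinateRing V) h
  have hq' : algebraMap (coordinateRing V) (RationalFunctions V) q ≠ 0 :=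
    IsFractionRing.to_map_ne_zero_of_mem_nonZeroDivisors hq
  have hp : p = 0 := by
    refine coordinateRing.eq_zero_of_forall_mem_isOpen hU hne fun v hv => ?_
    obtain ⟨p', q', hqv, e, h0⟩ := hh v hv
    have h0' : (p' : V → ℂ) v = 0 := by simpa [hqv] using h0.symm
    have hpq : p * q' = p' * q := by
      apply IsFractionRing.injective (coordinateRing V) (RationalFunctions V)
      rw [map_mul, map_mul, ← e]
      field_simp
    have hv' : (p : V → ℂ) v * (q' : V → ℂ) v = (p' : V → ℂ) v * (q : V → ℂ) v :=
      congrFun (congrArg Subtype.val hpq) v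
    rw [h0', zero_mul] at hv'
    exact (mul_eq_zero.1 hv').resolve_right hqv
  rw [hp, map_zero, zero_div]

end CoordinateRing

/-! ### Polynomials of least degree in an ideal of `A[X]` -/

section Relations

open Polynomial

theorem Polynomial.coeff_taylor_of_natDegree_eq_succ {R : Type*} [CommRing R] {P : R[X]} {m : ℕ}
    (hP : P.natDegree = m + 1) (c : R) :
    (taylor c P).coeff m = P.coeff m + (m + 1) * P.coeff (m + 1) * c := by
  have hdeg : (hasseDeriv m P).natDegree < 2 := by
    have := natDegree_hasseDeriv_le P m
    omega
  rw [taylor_coeff, eval_eq_sum_range' hdeg, Finset.sum_range_succ, Finset.sum_range_one,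
    hasseDeriv_coeff, hasseDeriv_coeff]
  simp [add_comm 1 m]

/-- The nonzero elements of least degree of an ideal of `A[X]` are proportional over the fraction
field of `A`. -/
theorem Polynomial.C_leadingCoeff_mul_eq_of_natDegree_minimal {A : Type*} [CommRing A] [IsDomain A]
    {I : Ideal A[X]} {P Q : A[X]} (hP : P ∈ I) (hQ : Q ∈ I) (hP0 : P ≠ 0)
    (hPQ : Q.natDegree = P.natDegree) (hmin : ∀ R ∈ I, R ≠ 0 → P.natDegree ≤ R.natDegree) :
    C Q.leadingCoeff * P = C P.leadingCoeff * Q := by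
  by_cases hQ0 : Q = 0
  · simp [hQ0]
  by_contra hne
  have hmem : C Q.leadingCoeff * P - C P.leadingCoeff * Q ∈ I :=
    I.sub_mem (I.mul_mem_left _ hP) (I.mul_mem_left _ hQ)
  have hlcP : P.leadingCoeff ≠ 0 := leadingCoeff_ne_zero.2 hP0
  have hlcQ : Q.leadingCoeff ≠ 0 := leadingCoeff_ne_zero.2 hQ0
  have hdeg : degree (C Q.leadingCoeff * P - C P.leadingCoeff * Q) <
      degree (C Q.leadingCoeff * P) := by
    refine degree_sub_lt_left ?_ (mul_ne_zero (C_ne_zero.2 hlcQ) hP0) ?_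
    · rw [degree_C_mul hlcQ, degree_C_mul hlcP, degree_eq_natDegree hP0, degree_eq_natDegree hQ0,
        hPQ]
    · simp [mul_comm]
  rw [degree_C_mul hlcQ, degree_eq_natDegree hP0,
    degree_eq_natDegree (sub_ne_zero.2 hne), Nat.cast_lt] at hdeg
  exact absurd (hmin _ hmem (sub_ne_zero.2 hne)) (not_le.2 hdeg)

end Relations

/-! ### Algebraic relations satisfied by an additive function -/

section Descent

open Polynomial

variable {G V : Type*} [Group G] [AddCommGroup V] [Module ℂ V]

/-- The polynomials `P ∈ ℂ[V][T]` with `P (ρ g v, Φ g) = 0` for all `g`. -/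
noncomputable def graphIdeal (ρ : Representation ℂ G V) (v : V) (Φ : G → ℂ) :
    Ideal (coordinateRing V)[X] :=
  ⨅ g : G, RingHom.ker (eval₂RingHom (coordinateRing.eval (ρ g v) : coordinateRing V →+* ℂ) (Φ g))

theorem mem_graphIdeal {ρ : Representation ℂ G V} {v : V} {Φ : G → ℂ} {P : (coordinateRing V)[X]} :
    P ∈ graphIdeal ρ v Φ ↔
      ∀ g, P.eval₂ (coordinateRing.eval (ρ g v) : coordinateRing V →+* ℂ) (Φ g) = 0 := by
  simp [graphIdeal, RingHom.mem_ker]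

/-- If `Φ` is constant on the fibres of the orbit map `g ↦ ρ g v`, then it is algebraic over `ℂ[V]`.
Otherwise `g ↦ (ρ g v, Φ g)` is a dominant morphism to `V × ℂ`, so that for a general `w` its image
contains `(w, c)` for all but finitely many `c`; but it contains at most one such point. -/
theorem graphIdeal_ne_bot [FiniteDimensional ℂ V] {O : Subalgebra ℂ (G → ℂ)}
    (hO : IsLinearAlgebraicGroup O) {ρ : Representation ℂ G V} (hρ : IsRationalRepresentation O ρ)
    (v : V) {Φ : G → ℂ} (hΦ : Φ ∈ O) (hfib : ∀ g g' : G, ρ g v = ρ g' v → Φ g = Φ g') :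
    graphIdeal ρ v Φ ≠ ⊥ := by
  intro hbot
  let f : (coordinateRing V)[X] →ₐ[ℂ] O := eval₂AlgHom
    (coordinateRing.pullback (fun g : G => ρ g v) fun l => hρ l v) ⟨Φ, hΦ⟩
    fun _ => Commute.all _ _
  have hf : ∀ (P : (coordinateRing V)[X]) (g : G), (f P : G → ℂ) g =
      P.eval₂ (coordinateRing.eval (ρ g v) : coordinateRing V →+* ℂ) (Φ g) := fun P g =>
    hom_eval₂ P _ ((Pi.evalRingHom (fun _ : G => ℂ) g).comp (O.val : O →+* (G → ℂ))) _
  have hinj : Function.Injective f := by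
    rw [injective_iff_map_eq_zero]
    intro P hP
    rw [← Ideal.mem_bot, ← hbot, mem_graphIdeal]
    intro g
    rw [← hf, hP]
    rfl
  have : Algebra.FiniteType ℂ O := O.fg_iff_finiteType.1 hO.finitely_generated
  obtain ⟨s, hs, H⟩ := AlgHom.exists_forall_apply_ne_zero_exists_comp_eq
    (k := ℂ) (A := (coordinateRing V)[X]) (B := O) f hinj
  -- Over this `w` only the finitely many roots `c` of `s (w, T)` can be missed by the image.
  obtain ⟨w, hw⟩ : ∃ w : V, (s.leadingCoeff : V → ℂ) w ≠ 0 := by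
    by_contra! h
    exact leadingCoeff_ne_zero.2 hs (Subtype.ext (funext h))
  have hsw : s.map (coordinateRing.eval w : coordinateRing V →+* ℂ) ≠ 0 := fun h => hw <| by
    simpa using congrArg (fun Q => Q.coeff s.natDegree) h
  have hlift : ∀ c : ℂ, (s.map (coordinateRing.eval w : coordinateRing V →+* ℂ)).eval c ≠ 0 →
      ∃ g : G, ρ g v = w ∧ Φ g = c := by
    intro c hc
    obtain ⟨ψ, hψ⟩ := H (eval₂AlgHom (coordinateRing.eval w) c fun _ => Commute.all _ _) (by
      rw [eval_map] at hc
      exact hc)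
    obtain ⟨g, hg, -⟩ := hO.points ψ
    have hval : ∀ P : (coordinateRing V)[X],
        P.eval₂ (coordinateRing.eval (ρ g v) : coordinateRing V →+* ℂ) (Φ g) =
          P.eval₂ (coordinateRing.eval w : coordinateRing V →+* ℂ) c := fun P => by
      rw [← hf, ← hg]
      exact DFunLike.congr_fun hψ P
    refine ⟨g, ?_, by simpa using hval X⟩
    refine sub_eq_zero.1 ((Module.forall_dual_apply_eq_zero_iff ℂ _).1 fun l => ?_)
    rw [map_sub, sub_eq_zero]
    simpa using hval (C ⟨fun v => l v, Algebra.subset_adjoin ⟨l, rfl⟩⟩)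
  have hfin : {c | (s.map (coordinateRing.eval w : coordinateRing V →+* ℂ)).IsRoot c}.Finite :=
    finite_setOfPred_isRoot hsw
  obtain ⟨c, hc, c', hc', hne⟩ := (hfin.infinite_compl).nontrivial
  obtain ⟨g, hgw, rfl⟩ := hlift c hc
  obtain ⟨g', hgw', rfl⟩ := hlift c' hc'
  exact hne (hfib g g' (hgw.trans hgw'.symm))

/-- The substitution `(v, T) ↦ (ρ g v, T + Φ g)` preserves the graph ideal. -/
theorem taylor_map_precomp_mem_graphIdeal {ρ : Representation ℂ G V} {v : V} {Φ : G → ℂ}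
    (hΦ : ∀ x y, Φ (x * y) = Φ x + Φ y) {P : (coordinateRing V)[X]} (hP : P ∈ graphIdeal ρ v Φ)
    (g : G) :
    taylor (algebraMap ℂ (coordinateRing V) (Φ g))
      (P.map (coordinateRing.precomp (ρ g) : coordinateRing V →+* coordinateRing V)) ∈
        graphIdeal ρ v Φ := by
  rw [mem_graphIdeal] at hP ⊢
  intro x
  have hcomp : (coordinateRing.eval (ρ x v) : coordinateRing V →+* ℂ).comp
      (coordinateRing.precomp (ρ g) : coordinateRing V →+* coordinateRing V) =
        (coordinateRing.eval (ρ (g * x) v) : coordinateRing V →+* ℂ) := by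
    ext p
    simp
  rw [← eval_map, map_taylor, map_map, hcomp, taylor_eval, ← hP (g * x), eval_map, hΦ,
    add_comm (Φ g)]
  simp

theorem IsPrehomogeneous.eq_range {O : Subalgebra ℂ (G → ℂ)} {ρ : Representation ℂ G V} {Ω : Set V}
    (hprehom : IsPrehomogeneous O ρ Ω) {v₀ : V} (hv₀ : v₀ ∈ Ω) :
    Ω = Set.range fun g : G => ρ g v₀ := by
  obtain ⟨v, rfl⟩ := hprehom.orbit
  obtain ⟨g₀, rfl⟩ := hv₀
  ext w
  constructor
  · rintro ⟨g, rfl⟩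
    refine ⟨g * g₀⁻¹, ?_⟩
    simp only [← Module.End.mul_apply, ← map_mul, inv_mul_cancel_right]
  · rintro ⟨g, rfl⟩
    refine ⟨g * g₀, ?_⟩
    simp only [← Module.End.mul_apply, ← map_mul]

theorem coordinateRing.precomp_injective (ρ : Representation ℂ G V) (g : G) :
    Function.Injective (coordinateRing.precomp (ρ g)) := by
  intro p q h
  refine Subtype.ext (funext fun v => ?_)
  have hv := congrFun (congrArg Subtype.val h) (ρ g⁻¹ v)
  simpa [← Module.End.mul_apply, ← map_mul] using hv

/-- A polynomial of positive least degree in the graph ideal exists, because the orbit is dense. -/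
theorem exists_mem_graphIdeal_minimal [FiniteDimensional ℂ V] {O : Subalgebra ℂ (G → ℂ)}
    {ρ : Representation ℂ G V} {Ω : Set V} (hprehom : IsPrehomogeneous O ρ Ω) {v₀ : V}
    (hv₀ : v₀ ∈ Ω) {Φ : G → ℂ} (hΦ : Φ ∈ additiveFunctions O)
    (hiso : ∀ g ∈ isotropy ρ v₀, Φ g = 0) :
    ∃ P ∈ graphIdeal ρ v₀ Φ, P.natDegree ≠ 0 ∧
      ∀ R ∈ graphIdeal ρ v₀ Φ, R ≠ 0 → P.natDegree ≤ R.natDegree := by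
  have hfib : ∀ g g' : G, ρ g v₀ = ρ g' v₀ → Φ g = Φ g' := by
    intro g g' h
    have hmem : g'⁻¹ * g ∈ isotropy ρ v₀ := by
      change ρ (g'⁻¹ * g) v₀ = v₀
      rw [map_mul, Module.End.mul_apply, h, ← Module.End.mul_apply, ← map_mul, inv_mul_cancel,
        map_one, Module.End.one_apply]
    have := hΦ.2 g' (g'⁻¹ * g)
    rwa [mul_inv_cancel_left, hiso _ hmem, add_zero] at this
  obtain ⟨P₀, hP₀, hP₀0⟩ := Submodule.exists_mem_ne_zero_of_ne_bot
    (graphIdeal_ne_bot hprehom.algebraic hprehom.rational v₀ hΦ.1 hfib)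
  obtain ⟨P, ⟨hP, hP0⟩, hmin⟩ := (InvImage.wf natDegree wellFounded_lt).has_min
    {P : (coordinateRing V)[X] | P ∈ graphIdeal ρ v₀ Φ ∧ P ≠ 0} ⟨P₀, hP₀, hP₀0⟩
  refine ⟨P, hP, fun hdeg => hP0 ?_, fun R hR hR0 => not_lt.1 (hmin R ⟨hR, hR0⟩)⟩
  rw [eq_C_of_natDegree_eq_zero hdeg] at hP ⊢
  rw [C_eq_zero]
  refine coordinateRing.eq_zero_of_forall_mem_isOpen hprehom.isOpen ⟨v₀, hv₀⟩ fun w hw => ?_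
  rw [hprehom.eq_range hv₀] at hw
  obtain ⟨g, rfl⟩ := hw
  simpa using mem_graphIdeal.1 hP g

/-- Let `α T ^ n + β T ^ (n - 1) + ⋯` be a polynomial of least degree in the graph ideal. Then `G`
acts on it by the substitution `(v, T) ↦ (ρ g v, T + Φ g)` up to proportionality, and comparison of
the two leading coefficients shows that `b / a = - β / (n α)` changes by `Φ g` under `g`. The identity
is stated without denominators. -/
theorem exists_polynomial_mul_eq_add [FiniteDimensional ℂ V] {O : Subalgebra ℂ (G → ℂ)}
    {ρ : Representation ℂ G V} {Ω : Set V} (hprehom : IsPrehomogeneous O ρ Ω) {v₀ : V}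
    (hv₀ : v₀ ∈ Ω) {Φ : G → ℂ} (hΦ : Φ ∈ additiveFunctions O)
    (hiso : ∀ g ∈ isotropy ρ v₀, Φ g = 0) :
    ∃ a b : coordinateRing V, a ≠ 0 ∧ ∀ (g : G) (v : V), (b : V → ℂ) (ρ g v) * (a : V → ℂ) v =
      (b : V → ℂ) v * (a : V → ℂ) (ρ g v) + Φ g * ((a : V → ℂ) v * (a : V → ℂ) (ρ g v)) := by
  obtain ⟨P, hP, hdeg, hmin⟩ := exists_mem_graphIdeal_minimal hprehom hv₀ hΦ hiso
  obtain ⟨m, hm⟩ := Nat.exists_eq_succ_of_ne_zero hdeg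
  have hP0 : P ≠ 0 := fun h => hdeg (by rw [h, natDegree_zero])
  have hm0 : (m + 1 : ℂ) ≠ 0 := Nat.cast_add_one_ne_zero m
  have hlc : P.coeff (m + 1) ≠ 0 := by
    rw [← Nat.succ_eq_add_one, ← hm]
    exact leadingCoeff_ne_zero.2 hP0
  -- `a` is `n` times the leading coefficient of `P`, `n = m + 1`, and `b` is minus the next one.
  refine ⟨(m + 1 : ℂ) • P.coeff (m + 1), -P.coeff m, smul_ne_zero hm0 hlc, fun g v => ?_⟩
  set τ : coordinateRing V →+* coordinateRing V :=
    (coordinateRing.precomp (ρ g) : coordinateRing V →+* coordinateRing V) with hτ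
  have hτinj : Function.Injective τ := coordinateRing.precomp_injective ρ g
  have hQ := taylor_map_precomp_mem_graphIdeal hΦ.2 hP g
  have hmdeg : (P.map τ).natDegree = m + 1 := by
    rw [natDegree_map_eq_of_injective hτinj, hm]
  have hprop := congrArg (fun R => (R.coeff m : V → ℂ) v)
    (C_leadingCoeff_mul_eq_of_natDegree_minimal hP hQ hP0
      (by rw [natDegree_taylor, natDegree_map_eq_of_injective hτinj]) hmin)
  simp only [coeff_C_mul, leadingCoeff_taylor] at hprop
  rw [coeff_taylor_of_natDegree_eq_succ hmdeg, leadingCoeff_map_of_injective hτinj, leadingCoeff,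
    hm, coeff_map, coeff_map] at hprop
  have hprop' : (P.coeff (m + 1) : V → ℂ) (ρ g v) * (P.coeff m : V → ℂ) v =
      (P.coeff (m + 1) : V → ℂ) v * ((P.coeff m : V → ℂ) (ρ g v) +
        (m + 1) * (P.coeff (m + 1) : V → ℂ) (ρ g v) * Φ g) := by
    simpa [hτ] using hprop
  change -(P.coeff m : V → ℂ) (ρ g v) * ((m + 1) * (P.coeff (m + 1) : V → ℂ) v) =
    -(P.coeff m : V → ℂ) v * ((m + 1) * (P.coeff (m + 1) : V → ℂ) (ρ g v)) +
      Φ g * ((m + 1) * (P.coeff (m + 1) : V → ℂ) v *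
        ((m + 1) * (P.coeff (m + 1) : V → ℂ) (ρ g v)))
  linear_combination (m + 1 : ℂ) * hprop'

end Descent

/-! ### Additive relative invariants -/

section Invariants

variable {G V : Type*} [Group G] [AddCommGroup V] [Module ℂ V]

theorem map_eq_zero_of_mem_commutatorIsotropy {ρ : Representation ℂ G V} {v : V} {Φ : G → ℂ}
    (hΦ : ∀ x y, Φ (x * y) = Φ x + Φ y) (hiso : ∀ g ∈ isotropy ρ v, Φ g = 0) {g : G}
    (hg : g ∈ commutatorIsotropy ρ v) : Φ g = 0 := by
  let F : G →* Multiplicative ℂ := MonoidHom.mk' (fun g => Multiplicative.ofAdd (Φ g)) hΦ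
  have hle : commutatorIsotropy ρ v ≤ F.ker :=
    sup_le (Abelianization.commutator_subset_ker F) hiso
  exact hle hg

/-- An additive function of `G` that vanishes on the isotropy subgroup of a point of the open orbit
is associated to an additive relative invariant. -/
theorem exists_isAssociated [FiniteDimensional ℂ V] {O : Subalgebra ℂ (G → ℂ)}
    {ρ : Representation ℂ G V} {Ω : Set V} (hprehom : IsPrehomogeneous O ρ Ω) {v₀ : V}
    (hv₀ : v₀ ∈ Ω) {Φ : G → ℂ} (hΦ : Φ ∈ additiveFunctions O)
    (hiso : ∀ g ∈ isotropy ρ v₀, Φ g = 0) :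
    ∃ h : RationalFunctions V, IsAssociated O ρ Ω h Φ := by
  obtain ⟨a, b, ha, hab⟩ := exists_polynomial_mul_eq_add hprehom hv₀ hΦ hiso
  have ha' : algebraMap (coordinateRing V) (RationalFunctions V) a ≠ 0 :=
    (map_ne_zero_iff _ (IsFractionRing.injective _ _)).2 ha
  -- The transformation law exhibits `b / a = (b ∘ ρ g) / (a ∘ ρ g) - Φ g`, which has a value
  -- wherever `a ∘ ρ g` does not vanish.
  have hval : ∀ (g : G) (w : V), (a : V → ℂ) (ρ g w) ≠ 0 →
      HasValueAt (algebraMap (coordinateRing V) (RationalFunctions V) b /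
        algebraMap (coordinateRing V) (RationalFunctions V) a) w
        ((b : V → ℂ) (ρ g w) / (a : V → ℂ) (ρ g w) - Φ g) := by
    intro g w hw
    refine ⟨coordinateRing.precomp (ρ g) b - Φ g • coordinateRing.precomp (ρ g) a,
      coordinateRing.precomp (ρ g) a, hw, ?_, ?_⟩
    · rw [div_mul_eq_mul_div, div_eq_iff ha', ← map_mul, ← map_mul]
      congr 1
      refine Subtype.ext (funext fun v => ?_)
      change (b : V → ℂ) v * (a : V → ℂ) (ρ g v) =
        ((b : V → ℂ) (ρ g v) - Φ g * (a : V → ℂ) (ρ g v)) * (a : V → ℂ) v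
      linear_combination -hab g v
    · change _ = ((b : V → ℂ) (ρ g w) - Φ g * (a : V → ℂ) (ρ g w)) / (a : V → ℂ) (ρ g w)
      rw [sub_div, mul_div_cancel_right₀ _ hw]
  obtain ⟨z, hz⟩ : ∃ z : G, (a : V → ℂ) (ρ z v₀) ≠ 0 := by
    by_contra! h
    refine ha (coordinateRing.eq_zero_of_forall_mem_isOpen hprehom.isOpen ⟨v₀, hv₀⟩ fun w hw => ?_)
    rw [hprehom.eq_range hv₀] at hw
    obtain ⟨g, rfl⟩ := hw
    exact h g
  refine ⟨algebraMap (coordinateRing V) (RationalFunctions V) b /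
    algebraMap (coordinateRing V) (RationalFunctions V) a, hΦ, fun v hv g => ?_⟩
  rw [hprehom.eq_range hv₀] at hv
  obtain ⟨y, rfl⟩ := hv
  -- Both points are moved to the same point `ρ z v₀` of the locus `a ≠ 0`.
  have h₁ : ρ (z * y⁻¹ * g⁻¹) (ρ g (ρ y v₀)) = ρ z v₀ := by
    simp only [← Module.End.mul_apply, ← map_mul, mul_assoc, inv_mul_cancel_left, inv_mul_cancel,
      mul_one]
  have h₂ : ρ (z * y⁻¹) (ρ y v₀) = ρ z v₀ := by
    simp only [← Module.End.mul_apply, ← map_mul, mul_assoc, inv_mul_cancel, mul_one]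
  refine ⟨_, _, hval (z * y⁻¹ * g⁻¹) _ (by rwa [h₁]), hval (z * y⁻¹) _ (by rwa [h₂]), ?_⟩
  have h₃ : Φ (z * y⁻¹) = Φ (z * y⁻¹ * g⁻¹) + Φ g := by rw [← hΦ.2, inv_mul_cancel_right]
  rw [h₁, h₂, h₃]
  ring

theorem IsAssociated.eq_zero_of_mem_isotropy [FiniteDimensional ℂ V] {O : Subalgebra ℂ (G → ℂ)}
    {ρ : Representation ℂ G V} {Ω : Set V} {h : RationalFunctions V} {Φ : G → ℂ}
    (hh : IsAssociated O ρ Ω h Φ) {v : V} (hv : v ∈ Ω) {g : G} (hg : g ∈ isotropy ρ v) :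
    Φ g = 0 := by
  obtain ⟨a, b, ha, hb, hab⟩ := hh.2 v hv g
  rw [show ρ g v = v from hg] at ha
  rw [← hab, ha.unique hb, sub_self]

theorem IsAssociated.unique [FiniteDimensional ℂ V] {O : Subalgebra ℂ (G → ℂ)}
    {ρ : Representation ℂ G V} {Ω : Set V} (hne : Ω.Nonempty) {h : RationalFunctions V}
    {Φ Φ' : G → ℂ} (hh : IsAssociated O ρ Ω h Φ) (hh' : IsAssociated O ρ Ω h Φ') : Φ = Φ' := by
  obtain ⟨v, hv⟩ := hne
  funext g
  obtain ⟨a, b, ha, hb, hab⟩ := hh.2 v hv g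
  obtain ⟨a', b', ha', hb', hab'⟩ := hh'.2 v hv g
  rw [← hab, ← hab', ha.unique ha', hb.unique hb']

theorem IsAssociated.iff_exists_eq_add_const [FiniteDimensional ℂ V] {O : Subalgebra ℂ (G → ℂ)}
    {ρ : Representation ℂ G V} {Ω : Set V} (hprehom : IsPrehomogeneous O ρ Ω)
    {h₁ h₂ : RationalFunctions V} {Φ : G → ℂ} (H : IsAssociated O ρ Ω h₁ Φ) :
    IsAssociated O ρ Ω h₂ Φ ↔ ∃ c : ℂ, h₂ = h₁ + algebraMap ℂ (RationalFunctions V) c := by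
  constructor
  · intro H'
    have hne : Ω.Nonempty := by
      obtain ⟨v, hΩ⟩ := hprehom.orbit
      exact hΩ ▸ Set.range_nonempty _
    obtain ⟨v, hv⟩ := hne
    obtain ⟨-, b₁, -, hb₁, -⟩ := H.2 v hv 1
    obtain ⟨-, b₂, -, hb₂, -⟩ := H'.2 v hv 1
    refine ⟨b₂ - b₁, ?_⟩
    have hzero : h₂ + (algebraMap ℂ (RationalFunctions V) (-1) * h₁ +
        algebraMap ℂ (RationalFunctions V) (b₁ - b₂)) = 0 := by
      refine RationalFunctions.eq_zero_of_hasValueAt_zero hprehom.isOpen ⟨v, hv⟩ fun w hw => ?_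
      rw [hprehom.eq_range hv] at hw
      obtain ⟨g, rfl⟩ := hw
      obtain ⟨a, b, ha, hb, hab⟩ := H.2 v hv g
      obtain ⟨a', b', ha', hb', hab'⟩ := H'.2 v hv g
      convert ha'.add (((HasValueAt.const _ (-1)).mul ha).add (HasValueAt.const _ (b₁ - b₂)))
        using 1
      rw [hb₁.unique hb, hb₂.unique hb']
      linear_combination hab - hab'
    rw [RingHom.map_sub, RingHom.map_neg, RingHom.map_one] at hzero
    rw [RingHom.map_sub]
    linear_combination hzero
  · rintro ⟨c, rfl⟩
    refine ⟨H.1, fun v hv g => ?_⟩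
    obtain ⟨a, b, ha, hb, hab⟩ := H.2 v hv g
    exact ⟨a + c, b + c, ha.add (HasValueAt.const _ c), hb.add (HasValueAt.const _ c), by
      rw [← hab, add_sub_add_right_eq_sub]⟩

theorem comp_mk_mem_additiveFunctions {O : Subalgebra ℂ (G → ℂ)} {N : Subgroup G} [N.Normal]
    {Ψ : G ⧸ N → ℂ} (hΨ : Ψ ∈ additiveFunctions (quotientRegular O N)) :
    (fun g : G => Ψ (g : G ⧸ N)) ∈ additiveFunctions O :=
  ⟨hΨ.1, fun x y => hΨ.2 x y⟩

theorem exists_additiveFunctions_quotient {O : Subalgebra ℂ (G → ℂ)} {N : Subgroup G} [N.Normal]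
    {Φ : G → ℂ} (hΦ : Φ ∈ additiveFunctions O) (hN : ∀ g ∈ N, Φ g = 0) :
    ∃ Ψ ∈ additiveFunctions (quotientRegular O N), ∀ g : G, Ψ (g : G ⧸ N) = Φ g := by
  refine ⟨Quotient.lift Φ fun x y hxy => ?_, ⟨hΦ.1, ?_⟩, fun _ => rfl⟩
  · have h := hΦ.2 x (x⁻¹ * y)
    rw [mul_inv_cancel_left, hN _ (QuotientGroup.leftRel_apply.1 hxy), add_zero] at h
    exact h.symm
  · rintro ⟨x⟩ ⟨y⟩
    exact hΦ.2 x y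

theorem isAssociated_comp_mk [FiniteDimensional ℂ V] {O : Subalgebra ℂ (G → ℂ)}
    {ρ : Representation ℂ G V} {Ω : Set V} (hprehom : IsPrehomogeneous O ρ Ω) {v₀ : V}
    (hv₀ : v₀ ∈ Ω) {Ψ : G ⧸ commutatorIsotropy ρ v₀ → ℂ}
    (hΨ : Ψ ∈ additiveFunctions (quotientRegular O (commutatorIsotropy ρ v₀))) :
    ∃ h : RationalFunctions V,
      IsAssociated O ρ Ω h (fun g : G => Ψ (g : G ⧸ commutatorIsotropy ρ v₀)) := by
  refine exists_isAssociated hprehom hv₀ (comp_mk_mem_additiveFunctions hΨ) fun g hg => ?_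
  have hg' : (g : G ⧸ commutatorIsotropy ρ v₀) = 1 :=
    (QuotientGroup.eq_one_iff g).2 ((le_sup_right : isotropy ρ v₀ ≤ commutatorIsotropy ρ v₀) hg)
  have h1 := hΨ.2 1 1
  rw [mul_one, left_eq_add] at h1
  rw [hg', h1]

/-- An additive relative invariant determines an additive function of the quotient group. -/
theorem IsAssociated.exists_comp_mk_eq [FiniteDimensional ℂ V] {O : Subalgebra ℂ (G → ℂ)}
    {ρ : Representation ℂ G V} {Ω : Set V} {h : RationalFunctions V} {Φ : G → ℂ}
    (hh : IsAssociated O ρ Ω h Φ) {v₀ : V} (hv₀ : v₀ ∈ Ω) :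
    ∃ Ψ ∈ additiveFunctions (quotientRegular O (commutatorIsotropy ρ v₀)),
      ∀ g : G, Ψ (g : G ⧸ commutatorIsotropy ρ v₀) = Φ g :=
  exists_additiveFunctions_quotient hh.1 fun _ hg =>
    map_eq_zero_of_mem_commutatorIsotropy hh.1.2 (fun _ => hh.eq_zero_of_mem_isotropy hv₀) hg

end Invariants

theorem mainTheorem4 {G V : Type*} [Group G] [AddCommGroup V] [Module ℂ V]
    [FiniteDimensional ℂ V] (O : Subalgebra ℂ (G → ℂ)) (ρ : Representation ℂ G V) (Ω : Set V)
    (hprehom : IsPrehomogeneous O ρ Ω) (v₀ : V) (hv₀ : v₀ ∈ Ω) :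
    (∃ e : additiveFunctionsOne O ρ Ω ≃ₗ[ℂ]
        additiveFunctions (quotientRegular O (commutatorIsotropy ρ v₀)),
      ∀ (Φ : additiveFunctionsOne O ρ Ω) (g : G),
        (e Φ : G ⧸ commutatorIsotropy ρ v₀ → ℂ) (g : G ⧸ commutatorIsotropy ρ v₀) =
          (Φ : G → ℂ) g) ∧
    (∀ Ψ ∈ additiveFunctions (quotientRegular O (commutatorIsotropy ρ v₀)),
      ∃ h : RationalFunctions V,
        IsAssociated O ρ Ω h (fun g : G => Ψ (g : G ⧸ commutatorIsotropy ρ v₀))) ∧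
    (∀ h : RationalFunctions V, IsAdditiveRelativeInvariant O ρ Ω h →
      ∃! Ψ : G ⧸ commutatorIsotropy ρ v₀ → ℂ,
        Ψ ∈ additiveFunctions (quotientRegular O (commutatorIsotropy ρ v₀)) ∧
        IsAssociated O ρ Ω h (fun g : G => Ψ (g : G ⧸ commutatorIsotropy ρ v₀))) ∧
    (∀ (h₁ h₂ : RationalFunctions V) (Φ : G → ℂ), IsAssociated O ρ Ω h₁ Φ →
      (IsAssociated O ρ Ω h₂ Φ ↔
        ∃ c : ℂ, h₂ = h₁ + algebraMap ℂ (RationalFunctions V) c)) := by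

  refine ⟨?_, fun Ψ hΨ => isAssociated_comp_mk hprehom hv₀ hΨ, ?_,
    fun _ _ _ H => H.iff_exists_eq_add_const hprehom⟩
  · let F : additiveFunctions (quotientRegular O (commutatorIsotropy ρ v₀)) →ₗ[ℂ]
        additiveFunctionsOne O ρ Ω :=
      { toFun := fun Ψ => ⟨fun g => (Ψ : G ⧸ commutatorIsotropy ρ v₀ → ℂ) g,
          isAssociated_comp_mk hprehom hv₀ Ψ.2⟩
        map_add' := fun _ _ => rfl
        map_smul' := fun _ _ => rfl }
    have hF : Function.Bijective F := by
      constructor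
      · intro Ψ Ψ' h
        refine Subtype.ext (funext ?_)
        rintro ⟨g⟩
        exact congrFun (congrArg Subtype.val h) g
      · rintro ⟨Φ, h, hh⟩
        obtain ⟨Ψ, hΨ, hΨΦ⟩ := hh.exists_comp_mk_eq hv₀
        exact ⟨⟨Ψ, hΨ⟩, Subtype.ext (funext hΨΦ)⟩
    refine ⟨(LinearEquiv.ofBijective F hF).symm, fun Φ g => ?_⟩
    exact congrFun (congrArg Subtype.val ((LinearEquiv.ofBijective F hF).apply_symm_apply Φ)) g
  · rintro h ⟨Φ, hh⟩
    obtain ⟨Ψ, hΨ, hΨΦ⟩ := hh.exists_comp_mk_eq hv₀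
    refine ⟨Ψ, ⟨hΨ, (funext hΨΦ : (fun g : G => Ψ g) = Φ) ▸ hh⟩, fun Ψ' hΨ' => funext ?_⟩
    rintro ⟨g⟩
    exact (congrFun (hΨ'.2.unique ⟨v₀, hv₀⟩ hh) g).trans (hΨΦ g).symm
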